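/- Let $m,n,s$ be positive integers with $s\le n$. Equip $\mathbb H^n$ and $\mathbb H^m$ ($\mathbb H$ the real Hamilton quaternions) with the norm $\|\mathbf x\|_2=\bigl(\sum_i |x_i|^2\bigr)^{1/2}$, and let a matrix in $\mathbb H^{m\times n}$ act on $\mathbb H^n$ by the usual matrix-vector product $(\Phi\mathbf x)_i=\sum_j \phi_{ij}x_j$. A vector is $s$-sparse if it has at most $s$ nonzero coordinates. The $s$-restricted isometry constant $\delta_s$ of a matrix $\Phi\in\mathbb H^{m\times n}$ is the smallest number $\delta_s\ge 0$ such that $$(1-\delta_s)\|\mathbf x\|_2^2\le\|\Phi\mathbf x\|_2^2\le(1+\delta_s)\|\mathbf x\|_2^2\qquad\text{for all } s\text{-sparse } \mathbf x\in\mathbb H^n .$$ Theorem 4.2. Let $\Phi=(\phi_{ij})\in\mathbb H^{m\times n}$ be a random matrix whose entries $\phi_{ij}$ are independent quaternion random variables with distribution $\mathcal N_{\mathbb H}(0,\frac1m)$, that is, the four real components of each $\phi_{ij}$ are independent and each has distribution $\mathcal N(0,\frac1{4m})$. Let $\delta\in(0,\frac1{\sqrt3})$ and $\varepsilon\in(0,1)$.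 If $$m\ge\frac{10}{3}\,\delta^{-2}\Bigl(15s+\ln\Bigl(\frac2\varepsilon\Bigr)+s\ln\Bigl(\frac ns\Bigr)\Bigr),$$ then with probability at least $1-\varepsilon$ the $s$-restricted isometry constant $\delta_s$ of $\Phi$ satisfies $\delta_s<\delta$. -/

import Mathlib

open MeasureTheory ProbabilityTheory
open scoped Quaternion NNReal

/-- The space of quaternions carries its Borel σ-algebra. -/
noncomputable instance quaternionMeasurableSpace : MeasurableSpace ℍ := borel ℍ

instance quaternionBorelSpace : BorelSpace ℍ := ⟨rfl⟩

/-- `X ∼ 𝒩_ℍ(0, v)`: the four real components of `X` (in the order real part, `i`, `j`, `k`)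
are independent, and each of them has the distribution `𝒩(0, v / 4)`. -/
structure IsQuaternionGaussian {Ω : Type*} [MeasurableSpace Ω]
    (X : Ω → ℍ) (v : ℝ≥0) (P : Measure Ω) : Prop where
  hasLaw : ∀ k : Fin 4, HasLaw (fun ω => Quaternion.equivTuple ℝ (X ω) k) (gaussianReal 0 (v / 4)) P
  indep : iIndepFun (fun (k : Fin 4) (ω : Ω) => Quaternion.equivTuple ℝ (X ω) k) P

/-- A random `m × n` quaternion matrix whose entries are independent random variables
with the distribution `𝒩_ℍ(0, 1 / m)`. -/
structure IsQuaternionGaussianMatrix {Ω : Type*} [MeasurableSpace Ω] {m n : ℕ}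
    (Φ : Ω → Matrix (Fin m) (Fin n) ℍ) (P : Measure Ω) : Prop where
  entry : ∀ i j, IsQuaternionGaussian (fun ω => Φ ω i j) (1 / (m : ℝ≥0)) P
  indep : iIndepFun (fun (p : Fin m × Fin n) (ω : Ω) => Φ ω p.1 p.2) P

/-- The norm `‖x‖₂ = √(∑ i, |x i|²)` on `ℍⁿ`. -/
noncomputable def quaternionL2Norm {n : ℕ} (x : Fin n → ℍ) : ℝ :=
  Real.sqrt (∑ i, ‖x i‖ ^ 2)

/-- A vector is `s`-sparse if it has at most `s` nonzero coordinates. -/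
def IsSparse {n : ℕ} (s : ℕ) (x : Fin n → ℍ) : Prop :=
  {i | x i ≠ 0}.ncard ≤ s

/-- `Φ` satisfies the `s`-restricted isometry property with constant `δ`. The matrix acts by the
usual matrix-vector product, with the matrix entries multiplying the coordinates from the left. -/
def HasRIP {m n : ℕ} (Φ : Matrix (Fin m) (Fin n) ℍ) (s : ℕ) (δ : ℝ) : Prop :=
  ∀ x : Fin n → ℍ, IsSparse s x →
    (1 - δ) * quaternionL2Norm x ^ 2 ≤ quaternionL2Norm (Φ.mulVec x) ^ 2 ∧
    quaternionL2Norm (Φ.mulVec x) ^ 2 ≤ (1 + δ) * quaternionL2Norm x ^ 2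

/-- The `s`-restricted isometry constant: the smallest `δ ≥ 0` for which `Φ` satisfies the
`s`-restricted isometry property (the infimum is attained, see `isLeast_ric`). -/
noncomputable def ric {m n : ℕ} (Φ : Matrix (Fin m) (Fin n) ℍ) (s : ℕ) : ℝ :=
  sInf {δ : ℝ | 0 ≤ δ ∧ HasRIP Φ s δ}

lemma quaternionL2Norm_sq {n : ℕ} (x : Fin n → ℍ) :
    quaternionL2Norm x ^ 2 = ∑ i, ‖x i‖ ^ 2 :=
  Real.sq_sqrt (Finset.sum_nonneg fun _ _ => sq_nonneg _)

lemma isLeast_ric {m n : ℕ} (Φ : Matrix (Fin m) (Fin n) ℍ) (s : ℕ) :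
    IsLeast {δ : ℝ | 0 ≤ δ ∧ HasRIP Φ s δ} (ric Φ s) := by
  have hbdd : BddBelow {δ : ℝ | 0 ≤ δ ∧ HasRIP Φ s δ} := ⟨0, fun δ h => h.1⟩
  have hclosed : IsClosed {δ : ℝ | 0 ≤ δ ∧ HasRIP Φ s δ} := by
    have : {δ : ℝ | 0 ≤ δ ∧ HasRIP Φ s δ} = {δ : ℝ | 0 ≤ δ} ∩ {δ : ℝ | HasRIP Φ s δ} := rfl
    rw [this]
    refine (isClosed_le continuous_const continuous_id).inter ?_
    simp only [HasRIP, Set.ofPred_forall, Set.ofPred_and]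
    refine isClosed_iInter fun x => isClosed_iInter fun _ => IsClosed.inter ?_ ?_
    · exact isClosed_le (by fun_prop) (by fun_prop)
    · exact isClosed_le (by fun_prop) (by fun_prop)
  have hne : {δ : ℝ | 0 ≤ δ ∧ HasRIP Φ s δ}.Nonempty := by
    set C : ℝ := ∑ i, (∑ j, ‖Φ i j‖) ^ 2 with hC
    have hC0 : 0 ≤ C := Finset.sum_nonneg fun _ _ => sq_nonneg _
    refine ⟨C + 1, by linarith, fun x _ => ?_⟩
    have hx0 : 0 ≤ quaternionL2Norm x := Real.sqrt_nonneg _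
    have hcoord : ∀ j, ‖x j‖ ≤ quaternionL2Norm x := fun j => by
      refine Real.le_sqrt_of_sq_le ?_
      exact Finset.single_le_sum (f := fun i => ‖x i‖ ^ 2) (fun _ _ => sq_nonneg _)
        (Finset.mem_univ j)
    have hbound : quaternionL2Norm (Φ.mulVec x) ^ 2 ≤ C * quaternionL2Norm x ^ 2 := by
      rw [quaternionL2Norm_sq, hC, Finset.sum_mul]
      refine Finset.sum_le_sum fun i _ => ?_
      rw [← mul_pow]
      refine pow_le_pow_left₀ (norm_nonneg _) ?_ 2
      rw [Matrix.mulVec, dotProduct, Finset.sum_mul]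
      refine (norm_sum_le _ _).trans (Finset.sum_le_sum fun j _ => ?_)
      rw [norm_mul]
      exact mul_le_mul_of_nonneg_left (hcoord j) (norm_nonneg _)
    have h1 : 0 ≤ quaternionL2Norm (Φ.mulVec x) ^ 2 := sq_nonneg _
    have h2 : 0 ≤ quaternionL2Norm x ^ 2 := sq_nonneg _
    constructor
    · nlinarith
    · nlinarith
  exact ⟨hclosed.csInf_mem hne hbdd, fun δ h => csInf_le hbdd h⟩

/-! For a fixed unit vector `x`, the characteristic function of `Φ x` depends on `x` only through
its norm, so `Φ x` has the law of a single column. Hence `‖Φ x‖²` is a sum of `4m` independent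
squared real Gaussians of variance `1/(4m)`, with moment generating function `(1 - θ/(2m))^(-2m)`.
Chernoff's bound gives deviation above `t` with probability at most `2 exp(-(5/8) m t²)`.

To reach all sparse vectors at once, each `s`-element support carries a real space of dimension
`4s`, whose unit sphere has a `ρ`-net of at most `(1 + 2/ρ)^(4s)` points. Error `t` on the net
becomes error `t / (1 - 2ρ)` on the whole space (`abs_norm_sq_sub_le_of_net`). A union bound over
nets and supports, with `ρ = 1/8` and `t = (7/10) δ`, finishes: there are at most `exp(15s + s
ln(n/s))` points, and the resulting constant is `(14/15) δ < δ`. -/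

open scoped RealInnerProductSpace

/-! ### Nets of the unit sphere and near-isometries -/

section Net

variable {E : Type*} [NormedAddCommGroup E] [NormedSpace ℝ E] [FiniteDimensional ℝ E]

/-- A `ρ`-separated subset of the unit ball has at most `(1 + 2 / ρ) ^ dim` elements. -/
theorem card_le_of_separated_unit_ball {ρ : ℝ} (hρ : 0 < ρ) (s : Finset E)
    (hs : ∀ c ∈ s, ‖c‖ ≤ 1) (h : ∀ c ∈ s, ∀ d ∈ s, c ≠ d → ρ ≤ ‖c - d‖) :
    (s.card : ℝ) ≤ (1 + 2 / ρ) ^ Module.finrank ℝ E := by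
  borelize E
  let μ : Measure E := Measure.addHaar
  have hρ2 : 0 < ρ / 2 := by positivity
  have hR : 0 < 1 + ρ / 2 := by positivity
  -- Volume comparison: disjoint balls of radius `ρ/2` fit in the ball of radius `1 + ρ/2`.
  have hdisj : Set.Pairwise (s : Set E)
      (Function.onFun Disjoint fun c => Metric.ball (c : E) (ρ / 2)) := by
    rintro c hc d hd hcd
    apply Metric.ball_disjoint_ball
    rw [dist_eq_norm, add_halves]
    exact h c hc d hd hcd
  have hsub : (⋃ c ∈ s, Metric.ball c (ρ / 2)) ⊆ Metric.ball (0 : E) (1 + ρ / 2) := by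
    refine Set.iUnion₂_subset fun x hx => Metric.ball_subset_ball' ?_
    rw [dist_zero_right]
    linarith [hs x hx]
  have hvol : (s.card : ENNReal) * ENNReal.ofReal ((ρ / 2) ^ Module.finrank ℝ E) *
      μ (Metric.ball 0 1) ≤
      ENNReal.ofReal ((1 + ρ / 2) ^ Module.finrank ℝ E) * μ (Metric.ball 0 1) := by
    rw [← μ.addHaar_ball_of_pos 0 hR]
    refine le_trans (le_of_eq ?_) (measure_mono hsub)
    rw [measure_biUnion_finset hdisj fun c _ => measurableSet_ball]
    simp only [μ.addHaar_ball_of_pos _ hρ2, Finset.sum_const, nsmul_eq_mul, mul_assoc]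
  have hcard := ENNReal.toReal_le_of_le_ofReal (pow_nonneg hR.le _)
    ((ENNReal.mul_le_mul_iff_left (Metric.measure_ball_pos _ _ zero_lt_one).ne'
      measure_ball_lt_top.ne).1 hvol)
  rw [ENNReal.toReal_mul, ENNReal.toReal_natCast, ENNReal.toReal_ofReal (by positivity),
    ← le_div_iff₀ (by positivity), ← div_pow] at hcard
  refine hcard.trans (le_of_eq ?_)
  congr 1
  field_simp
  ring

/-- The unit sphere has a `ρ`-net with at most `(1 + 2 / ρ) ^ dim` elements. -/
theorem exists_finset_net_unit_sphere {ρ : ℝ} (hρ : 0 < ρ) :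
    ∃ N : Finset E, (∀ c ∈ N, ‖c‖ = 1) ∧ (N.card : ℝ) ≤ (1 + 2 / ρ) ^ Module.finrank ℝ E ∧
      ∀ x : E, ‖x‖ = 1 → ∃ c ∈ N, ‖x - c‖ < ρ := by
  classical
  let p : Finset E → Prop := fun N =>
    (∀ c ∈ N, ‖c‖ = 1) ∧ ∀ c ∈ N, ∀ d ∈ N, c ≠ d → ρ ≤ ‖c - d‖
  have hcard : ∀ N, p N → (N.card : ℝ) ≤ (1 + 2 / ρ) ^ Module.finrank ℝ E := fun N hN =>
    card_le_of_separated_unit_ball hρ N (fun c hc => (hN.1 c hc).le) hN.2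
  let S : Set ℕ := {k | ∃ N, p N ∧ N.card = k}
  have hne : S.Nonempty := ⟨0, ∅, ⟨by simp, by simp⟩, rfl⟩
  have hbdd : BddAbove S := by
    refine ⟨⌊(1 + 2 / ρ) ^ Module.finrank ℝ E⌋₊, ?_⟩
    rintro _ ⟨N, hN, rfl⟩
    exact Nat.le_floor (hcard N hN)
  -- A separated set of largest cardinality is a net: a point far from all of it could be added.
  obtain ⟨N, hN, hNcard⟩ := Nat.sSup_mem hne hbdd
  refine ⟨N, hN.1, hcard N hN, fun x hx => ?_⟩
  by_contra! hfar
  have hxN : x ∉ N := fun hxN => by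
    have := hfar x hxN
    simp only [sub_self, norm_zero] at this
    linarith
  have hins : p (insert x N) := by
    refine ⟨fun c hc => ?_, fun c hc d hd hcd => ?_⟩
    · rcases Finset.mem_insert.1 hc with rfl | hc
      exacts [hx, hN.1 c hc]
    · rcases Finset.mem_insert.1 hc with rfl | hcN <;>
        rcases Finset.mem_insert.1 hd with rfl | hdN
      · exact absurd rfl hcd
      · exact hfar d hdN
      · rw [norm_sub_rev]
        exact hfar c hcN
      · exact hN.2 c hcN d hdN hcd
  have hle := le_csSup hbdd ⟨insert x N, hins, rfl⟩
  rw [Finset.card_insert_of_notMem hxN, ← hNcard] at hle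
  omega

end Net

/-- A linear map that is a near-isometry on a `ρ`-net of the unit sphere is a near-isometry. -/
theorem abs_norm_sq_sub_le_of_net {V W : Type*} [NormedAddCommGroup V] [InnerProductSpace ℝ V]
    [FiniteDimensional ℝ V] [NormedAddCommGroup W] [InnerProductSpace ℝ W] (T : V →ₗ[ℝ] W)
    {ρ t : ℝ} (hρ : 0 < ρ) (hρ' : 2 * ρ < 1) (N : Finset V) (hN : ∀ c ∈ N, ‖c‖ = 1)
    (hnet : ∀ x : V, ‖x‖ = 1 → ∃ c ∈ N, ‖x - c‖ < ρ)
    (hT : ∀ c ∈ N, |‖T c‖ ^ 2 - 1| ≤ t) (x : V) :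
    |‖T x‖ ^ 2 - ‖x‖ ^ 2| ≤ t / (1 - 2 * ρ) * ‖x‖ ^ 2 := by
  rcases eq_or_ne x 0 with rfl | hx0
  · simp
  have hscale : ∀ (y : V), y ≠ 0 → |‖T y‖ ^ 2 - ‖y‖ ^ 2| =
      |‖T (‖y‖⁻¹ • y)‖ ^ 2 - ‖‖y‖⁻¹ • y‖ ^ 2| * ‖y‖ ^ 2 := fun y hy => by
    have hy' : ‖y‖ ≠ 0 := norm_ne_zero_iff.2 hy
    rw [← abs_of_nonneg (sq_nonneg ‖y‖), ← abs_mul, abs_of_nonneg (sq_nonneg ‖y‖), map_smul,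
      norm_smul, norm_smul, norm_inv, norm_norm]
    congr 1
    field_simp
  have hunit : ∀ y : V, y ≠ 0 → ‖y‖⁻¹ • y ∈ Metric.sphere (0 : V) 1 := fun y hy => by
    simp [norm_smul, norm_ne_zero_iff.2 hy]
  have hcont : Continuous T := T.continuous_of_finiteDimensional
  obtain ⟨z, hz, hzmax⟩ := (isCompact_sphere (0 : V) 1).exists_isMaxOn ⟨_, hunit x hx0⟩
    (f := fun y => |‖T y‖ ^ 2 - ‖y‖ ^ 2|) (by fun_prop)
  set M := |‖T z‖ ^ 2 - ‖z‖ ^ 2| with hM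
  have hbound : ∀ y : V, |‖T y‖ ^ 2 - ‖y‖ ^ 2| ≤ M * ‖y‖ ^ 2 := fun y => by
    rcases eq_or_ne y 0 with rfl | hy
    · simp
    · rw [hscale y hy]
      exact mul_le_mul_of_nonneg_right (hzmax (hunit y hy)) (sq_nonneg _)
  have hz1 : ‖z‖ = 1 := by simpa using hz
  obtain ⟨c, hc, hzc⟩ := hnet z hz1
  have hc1 := hN c hc
  have hM0 : 0 ≤ M := abs_nonneg _
  -- For `Q y = ‖T y‖² - ‖y‖²` with polar form `B`, `Q z - Q c = B (z - c) (z + c)`. The factor `2 /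
  -- ρ` balances the arguments, so that both have norm at most 2 before polarization.
  have hpolar : ‖T z‖ ^ 2 - ‖z‖ ^ 2 - (‖T c‖ ^ 2 - ‖c‖ ^ 2) =
      ρ / 8 * ((‖T ((2 / ρ) • (z - c) + (z + c))‖ ^ 2 - ‖(2 / ρ) • (z - c) + (z + c)‖ ^ 2)
        - (‖T ((2 / ρ) • (z - c) - (z + c))‖ ^ 2 - ‖(2 / ρ) • (z - c) - (z + c)‖ ^ 2)) := by
    simp only [map_add, map_sub, map_smul, norm_add_sq_real, norm_sub_sq_real, inner_smul_left,
      inner_add_right, inner_sub_left, real_inner_self_eq_norm_sq, real_inner_comm]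
    simp only [conj_trivial]
    field_simp
    ring
  have h1 := abs_le.1 (hbound ((2 / ρ) • (z - c) + (z + c)))
  have h2 := abs_le.1 (hbound ((2 / ρ) • (z - c) - (z + c)))
  have hpar := parallelogram_law_with_norm ℝ ((2 / ρ) • (z - c)) (z + c)
  have hu : ‖(2 / ρ) • (z - c)‖ ≤ 2 := by
    rw [norm_smul, Real.norm_of_nonneg (by positivity), div_mul_eq_mul_div, div_le_iff₀ hρ]
    linarith
  have hv : ‖z + c‖ ≤ 2 := (norm_add_le _ _).trans (by linarith)
  have hsum : ‖(2 / ρ) • (z - c) + (z + c)‖ ^ 2 + ‖(2 / ρ) • (z - c) - (z + c)‖ ^ 2 ≤ 16 := by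
    nlinarith [norm_nonneg ((2 / ρ) • (z - c)), norm_nonneg (z + c)]
  have hdiff : |‖T z‖ ^ 2 - ‖z‖ ^ 2 - (‖T c‖ ^ 2 - ‖c‖ ^ 2)| ≤ 2 * ρ * M := by
    have hsumM := mul_le_mul_of_nonneg_left hsum hM0
    rw [hpolar, abs_mul, abs_of_pos (by positivity : 0 < ρ / 8)]
    have : |(‖T ((2 / ρ) • (z - c) + (z + c))‖ ^ 2 - ‖(2 / ρ) • (z - c) + (z + c)‖ ^ 2)
        - (‖T ((2 / ρ) • (z - c) - (z + c))‖ ^ 2 - ‖(2 / ρ) • (z - c) - (z + c)‖ ^ 2)|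
        ≤ M * 16 := abs_le.2 ⟨by linarith [h1.1, h2.2], by linarith [h1.2, h2.1]⟩
    calc _ ≤ ρ / 8 * (M * 16) := by gcongr
      _ = 2 * ρ * M := by ring
  -- Since `z` attains the maximum, `M ≤ t + 2ρM`.
  have hMle : M ≤ t / (1 - 2 * ρ) := by
    rw [le_div_iff₀ (by linarith)]
    have htc := hT c hc
    rw [hc1, one_pow] at hdiff
    have := abs_sub_abs_le_abs_sub (‖T z‖ ^ 2 - ‖z‖ ^ 2) (‖T c‖ ^ 2 - 1)
    linarith
  exact (hbound x).trans (mul_le_mul_of_nonneg_right hMle (sq_nonneg _))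

/-! ### Transforms of real and quaternion Gaussians -/

theorem integral_cexp_mul_of_hasLaw_gaussianReal {Ω : Type*} [MeasurableSpace Ω] {P : Measure Ω}
    {X : Ω → ℝ} {v : ℝ≥0} (hX : HasLaw X (gaussianReal 0 v) P) (a : ℝ) :
    ∫ ω, Complex.exp (a * X ω * Complex.I) ∂P = Complex.exp (-(v * a ^ 2 / 2)) := by
  have h := charFun_gaussianReal (μ := 0) (v := v) a
  rw [← hX.map_eq, charFun_apply_real, integral_map hX.aemeasurable (by fun_prop)] at h
  rw [h]
  simp

/-- The moment generating function of the square of a centred Gaussian variable. -/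
theorem integral_exp_mul_sq_of_hasLaw_gaussianReal {Ω : Type*} [MeasurableSpace Ω] {P : Measure Ω}
    {X : Ω → ℝ} {v : ℝ≥0} (hv : v ≠ 0) (hX : HasLaw X (gaussianReal 0 v) P) {θ : ℝ}
    (hθ : 2 * v * θ < 1) :
    ∫ ω, Real.exp (θ * X ω ^ 2) ∂P = (√(1 - 2 * v * θ))⁻¹ := by
  have hv' : (0 : ℝ) < v := by positivity
  have hb : 0 < 1 / (2 * v) - θ := by
    rw [sub_pos, lt_div_iff₀ (by positivity)]
    linarith
  have h1 := integral_map (f := fun x : ℝ => Real.exp (θ * x ^ 2)) hX.aemeasurable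
    (by fun_prop)
  rw [← h1, hX.map_eq, integral_gaussianReal_eq_integral_smul hv]
  have h2 : ∀ x : ℝ, gaussianPDFReal 0 v x • Real.exp (θ * x ^ 2) =
      (√(2 * Real.pi * v))⁻¹ * Real.exp (-(1 / (2 * v) - θ) * x ^ 2) := fun x => by
    rw [gaussianPDFReal, smul_eq_mul, mul_assoc, ← Real.exp_add]
    congr 2
    field_simp
    ring
  simp_rw [h2]
  rw [integral_const_mul, integral_gaussian, ← Real.sqrt_inv, ← Real.sqrt_inv,
    ← Real.sqrt_mul (by positivity)]
  congr 1
  have : 1 - 2 * v * θ ≠ 0 := by linarith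
  have h3 : (1 / (2 * v) - θ) = (1 - 2 * v * θ) / (2 * v) := by field_simp
  rw [h3]
  field_simp

namespace IsQuaternionGaussian

variable {Ω : Type*} [MeasurableSpace Ω] {P : Measure Ω} {X : Ω → ℍ} {v : ℝ≥0}

theorem aemeasurable (hX : IsQuaternionGaussian X v P) : AEMeasurable X P := by
  have h1 : AEMeasurable (fun ω => Quaternion.equivTuple ℝ (X ω)) P :=
    aemeasurable_pi_iff.2 fun k => (hX.hasLaw k).aemeasurable
  have h2 : Measurable fun a : Fin 4 → ℝ =>
      Quaternion.linearIsometryEquivTuple.symm (WithLp.toLp 2 a) := by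
    refine Continuous.measurable ?_
    fun_prop
  refine (h2.comp_aemeasurable h1).congr (Filter.Eventually.of_forall fun ω => ?_)
  exact Quaternion.linearIsometryEquivTuple.symm_apply_apply (X ω)

theorem integral_cexp_inner (hX : IsQuaternionGaussian X v P) (q : ℍ) :
    ∫ ω, Complex.exp (⟪X ω, q⟫ * Complex.I) ∂P = Complex.exp (-(v * ‖q‖ ^ 2 / 8)) := by
  have hinner : ∀ ω, Complex.exp (⟪X ω, q⟫ * Complex.I) =
      ∏ k, Complex.exp ((Quaternion.equivTuple ℝ q k : ℝ) *
        (Quaternion.equivTuple ℝ (X ω) k : ℝ) * Complex.I) := fun ω => by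
    rw [← Complex.exp_sum, Quaternion.inner_def]
    simp [Fin.sum_univ_four]
    congr 1
    ring
  simp_rw [hinner]
  rw [hX.indep.integral_fun_prod_comp
    (f := fun k x => Complex.exp ((Quaternion.equivTuple ℝ q k : ℝ) * (x : ℝ) * Complex.I))
    (fun k => (hX.hasLaw k).aemeasurable) (fun k => by fun_prop)]
  simp_rw [fun k => integral_cexp_mul_of_hasLaw_gaussianReal (hX.hasLaw k)
    (Quaternion.equivTuple ℝ q k)]
  rw [← Complex.exp_sum, ← Complex.ofReal_pow, sq ‖q‖, ← Quaternion.normSq_eq_norm_mul_self,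
    Quaternion.normSq_def']
  simp [Fin.sum_univ_four]
  congr 1
  ring

/-- The moment generating function of the squared norm of a quaternion Gaussian variable. -/
theorem mgf_norm_sq (hX : IsQuaternionGaussian X v P) (hv : v ≠ 0) {θ : ℝ} (hθ : v * θ < 2) :
    mgf (fun ω => ‖X ω‖ ^ 2) P θ = ((1 - v * θ / 2) ^ 2)⁻¹ := by
  have hnorm : ∀ ω, Real.exp (θ * ‖X ω‖ ^ 2) =
      ∏ k, Real.exp (θ * Quaternion.equivTuple ℝ (X ω) k ^ 2) := fun ω => by
    rw [← Real.exp_sum, sq ‖X ω‖, ← Quaternion.normSq_eq_norm_mul_self, Quaternion.normSq_def']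
    simp [Fin.sum_univ_four]
    ring
  have hv4 : 2 * ((v / 4 : ℝ≥0) : ℝ) * θ = v * θ / 2 := by
    push_cast
    ring
  rw [mgf]
  simp_rw [hnorm]
  rw [hX.indep.integral_fun_prod_comp (f := fun k x => Real.exp (θ * x ^ 2))
    (fun k => (hX.hasLaw k).aemeasurable) (fun k => by fun_prop)]
  simp_rw [fun k => integral_exp_mul_sq_of_hasLaw_gaussianReal (θ := θ) (by positivity)
    (hX.hasLaw k) (by rw [hv4]; linarith)]
  rw [hv4, Finset.prod_const, Finset.card_univ, Fintype.card_fin, inv_pow]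
  congr 1
  rw [show 4 = 2 * 2 from rfl, pow_mul, Real.sq_sqrt (by linarith)]

end IsQuaternionGaussian

/-! ### The law of `Φ x` -/

namespace IsQuaternionGaussianMatrix

variable {Ω : Type*} [MeasurableSpace Ω] {P : Measure Ω} {m n : ℕ}
  {Φ : Ω → Matrix (Fin m) (Fin n) ℍ}

theorem aemeasurable_mulVec (hΦ : IsQuaternionGaussianMatrix Φ P) (x : Fin n → ℍ) :
    AEMeasurable (fun ω => WithLp.toLp 2 ((Φ ω).mulVec x)) P := by
  have h1 : AEMeasurable (fun ω => (Φ ω).mulVec x) P := by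
    refine aemeasurable_pi_iff.2 fun i => ?_
    simp only [Matrix.mulVec, dotProduct]
    refine Finset.aemeasurable_fun_sum _ fun j _ => ?_
    have hmul : Measurable fun q : ℍ => q * x j :=
      (continuous_id.mul continuous_const).measurable
    exact hmul.comp_aemeasurable (hΦ.entry i j).aemeasurable
  exact (WithLp.measurable_toLp 2 (Fin m → ℍ)).comp_aemeasurable h1

/-- Right multiplication by `x j` has adjoint right multiplication by `star (x j)`, so the exponent
splits into independent terms `⟪Φ i j, h i * star (x j)⟫`; norms multiply despite noncommutativity.
-/
theorem charFun_map_mulVec (hΦ : IsQuaternionGaussianMatrix Φ P) (x : Fin n → ℍ)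
    (h : PiLp 2 fun _ : Fin m => ℍ) :
    charFun (P.map fun ω => WithLp.toLp 2 ((Φ ω).mulVec x)) h =
      Complex.exp (-((1 / (m : ℝ)) * (quaternionL2Norm x ^ 2 * ‖h‖ ^ 2) / 8) : ℝ) := by
  rw [charFun_apply, integral_map (hΦ.aemeasurable_mulVec x) (by fun_prop)]
  have hinner : ∀ ω, Complex.exp (⟪WithLp.toLp 2 ((Φ ω).mulVec x), h⟫ * Complex.I) =
      ∏ p : Fin m × Fin n, Complex.exp (⟪Φ ω p.1 p.2, h p.1 * star (x p.2)⟫ * Complex.I) :=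
    fun ω => by
      rw [← Complex.exp_sum, ← Finset.sum_mul, ← Complex.ofReal_sum, PiLp.inner_apply,
        Fintype.sum_prod_type]
      congr 3
      refine Finset.sum_congr rfl fun i _ => ?_
      simp only [Matrix.mulVec, dotProduct]
      rw [sum_inner]
      refine Finset.sum_congr rfl fun j _ => ?_
      simp [Quaternion.inner_def, mul_assoc]
  simp_rw [hinner]
  rw [hΦ.indep.integral_fun_prod_comp
    (f := fun p q => Complex.exp (⟪q, h p.1 * star (x p.2)⟫ * Complex.I))
    (fun p => (hΦ.entry p.1 p.2).aemeasurable)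
    (fun p => Continuous.aestronglyMeasurable (by fun_prop))]
  simp_rw [fun p : Fin m × Fin n => (hΦ.entry p.1 p.2).integral_cexp_inner]
  rw [← Complex.exp_sum]
  congr 1
  rw [quaternionL2Norm_sq, PiLp.norm_sq_eq_of_L2, Finset.sum_mul_sum, Finset.sum_comm,
    Fintype.sum_prod_type]
  push_cast
  simp only [norm_mul, norm_star, Finset.mul_sum, Finset.sum_div, ← Finset.sum_neg_distrib]
  refine Finset.sum_congr rfl fun i _ => Finset.sum_congr rfl fun j _ => ?_
  push_cast
  ring

/-- The moment generating function of `‖Φ x‖₂²` for a unit vector `x`. -/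
theorem mgf_norm_mulVec_sq [IsProbabilityMeasure P] (hΦ : IsQuaternionGaussianMatrix Φ P)
    (hm : m ≠ 0) {x : Fin n → ℍ} (hx : quaternionL2Norm x = 1) {θ : ℝ} (hθ : θ < 2 * m) :
    mgf (fun ω => quaternionL2Norm ((Φ ω).mulVec x) ^ 2) P θ =
      ((1 - θ / (2 * m)) ^ (2 * m))⁻¹ := by
  have hm' : (0 : ℝ) < m := by positivity
  obtain ⟨j⟩ : Nonempty (Fin n) := by
    by_contra hn
    rw [not_nonempty_iff] at hn
    simp [quaternionL2Norm] at hx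
  have hsingle : quaternionL2Norm (Pi.single j (1 : ℍ)) = 1 := by
    rw [quaternionL2Norm, Finset.sum_eq_single j] <;> simp +contextual
  have hmap : P.map (fun ω => WithLp.toLp 2 ((Φ ω).mulVec x)) =
      P.map fun ω => WithLp.toLp 2 ((Φ ω).mulVec (Pi.single j 1)) := by
    have := Measure.isProbabilityMeasure_map (hΦ.aemeasurable_mulVec x)
    have := Measure.isProbabilityMeasure_map (hΦ.aemeasurable_mulVec (Pi.single j 1))
    refine Measure.ext_of_charFun (funext fun h => ?_)
    rw [hΦ.charFun_map_mulVec, hΦ.charFun_map_mulVec, hx, hsingle]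
  have hmgf : ∀ y : Fin n → ℍ, mgf (fun ω => quaternionL2Norm ((Φ ω).mulVec y) ^ 2) P θ =
      ∫ z, Real.exp (θ * ‖z‖ ^ 2) ∂(P.map fun ω => WithLp.toLp 2 ((Φ ω).mulVec y)) := fun y => by
    rw [integral_map (hΦ.aemeasurable_mulVec y)
      (Continuous.aestronglyMeasurable (by fun_prop)), mgf]
    simp_rw [PiLp.norm_sq_eq_of_L2, quaternionL2Norm_sq]
  rw [hmgf, hmap, ← hmgf]
  have hcol : (fun ω => quaternionL2Norm ((Φ ω).mulVec (Pi.single j 1)) ^ 2) =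
      ∑ i, fun ω => ‖Φ ω i j‖ ^ 2 := by
    ext ω
    simp [quaternionL2Norm_sq]
  have hind : iIndepFun (fun (i : Fin m) ω => ‖Φ ω i j‖ ^ 2) P :=
    (hΦ.indep.precomp (g := fun i : Fin m => (i, j)) fun a b hab => by simpa using hab).comp
      (fun _ q => ‖q‖ ^ 2) fun _ => by fun_prop
  have hmgfi : ∀ i, mgf (fun ω => ‖Φ ω i j‖ ^ 2) P θ = ((1 - θ / (2 * m)) ^ 2)⁻¹ := fun i => by
    rw [(hΦ.entry i j).mgf_norm_sq (by positivity)]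
    · push_cast
      congr 3
      field_simp
    · push_cast
      rw [one_div_mul_eq_div, div_lt_iff₀ hm']
      exact hθ
  rw [hcol, hind.mgf_sum₀ fun i => (hΦ.entry i j).aemeasurable.norm.pow_const 2]
  simp_rw [hmgfi]
  rw [Finset.prod_const, Finset.card_univ, Fintype.card_fin, inv_pow, ← pow_mul]

end IsQuaternionGaussianMatrix

/-! ### Chernoff tail bounds -/

theorem one_add_le_exp_sub_sq {t : ℝ} (ht : 0 ≤ t) (ht' : t ≤ 1 / 2) :
    1 + t ≤ Real.exp (t - 5 / 16 * t ^ 2) := by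
  -- The constant `5/16` suffices later because `2 * (5/16) * (7/10)² ≥ 3/10`.
  have h := Real.quadratic_le_exp_of_nonneg (x := t - 5 / 16 * t ^ 2) (by nlinarith)
  have hsq : 5 / 8 ≤ (1 - 5 / 16 * t) ^ 2 := by nlinarith
  have := mul_le_mul_of_nonneg_left hsq (sq_nonneg t)
  linarith [show t ^ 2 * (1 - 5 / 16 * t) ^ 2 = (t - 5 / 16 * t ^ 2) ^ 2 by ring]

theorem one_sub_le_exp_neg_sub_sq {t : ℝ} (ht : 0 ≤ t) (ht' : t < 1) :
    1 - t ≤ Real.exp (-t - 5 / 16 * t ^ 2) := by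
  have h := sum_le_hasSum (Finset.range 2) (fun k _ => by positivity)
    (Real.hasSum_pow_div_log_of_abs_lt_one (abs_lt.2 ⟨by linarith, ht'⟩))
  simp only [Finset.sum_range_succ, Finset.sum_range_zero] at h
  norm_num at h
  rw [← Real.log_le_iff_le_exp (by linarith)]
  nlinarith [sq_nonneg t]

namespace IsQuaternionGaussianMatrix

variable {Ω : Type*} [MeasurableSpace Ω] {P : Measure Ω} [IsProbabilityMeasure P] {m n : ℕ}
  {Φ : Ω → Matrix (Fin m) (Fin n) ℍ}

theorem integrable_exp_mul_norm_mulVec_sq (hΦ : IsQuaternionGaussianMatrix Φ P)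
    (hm : m ≠ 0) {x : Fin n → ℍ} (hx : quaternionL2Norm x = 1) {θ : ℝ} (hθ : θ < 2 * m) :
    Integrable (fun ω => Real.exp (θ * quaternionL2Norm ((Φ ω).mulVec x) ^ 2)) P := by
  -- A non-integrable function would have integral zero by convention.
  refine .of_integral_ne_zero ?_
  have h := hΦ.mgf_norm_mulVec_sq hm hx hθ
  rw [mgf] at h
  have hm' : (0 : ℝ) < m := by positivity
  have : 0 < 1 - θ / (2 * m) := by
    rw [sub_pos, div_lt_one (by positivity)]
    exact hθ
  rw [h]
  positivity

theorem measureReal_one_add_le (hΦ : IsQuaternionGaussianMatrix Φ P)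
    (hm : m ≠ 0) {x : Fin n → ℍ} (hx : quaternionL2Norm x = 1) {t : ℝ} (ht : 0 ≤ t)
    (ht' : t ≤ 1 / 2) :
    P.real {ω | 1 + t ≤ quaternionL2Norm ((Φ ω).mulVec x) ^ 2} ≤
      Real.exp (-(5 / 8 * m * t ^ 2)) := by
  have hm' : (0 : ℝ) < m := by positivity
  -- This `θ` minimizes the Chernoff bound, giving `((1 + t) exp(-t))^(2m)`.
  have hθ : 2 * m * t / (1 + t) < 2 * m := by
    rw [div_lt_iff₀ (by linarith)]
    linarith
  refine (measure_ge_le_exp_mul_mgf (1 + t) (by positivity)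
    (hΦ.integrable_exp_mul_norm_mulVec_sq hm hx hθ)).trans ?_
  rw [hΦ.mgf_norm_mulVec_sq hm hx hθ]
  have h1 : 1 - 2 * m * t / (1 + t) / (2 * m) = (1 + t)⁻¹ := by
    field_simp
    ring
  have h2 : -(2 * m * t / (1 + t)) * (1 + t) = -(2 * m * t) := by field_simp
  rw [h1, h2, inv_pow, inv_inv]
  calc Real.exp (-(2 * m * t)) * (1 + t) ^ (2 * m)
      ≤ Real.exp (-(2 * m * t)) * Real.exp (t - 5 / 16 * t ^ 2) ^ (2 * m) := by
        gcongr
        exact one_add_le_exp_sub_sq ht ht'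
    _ = Real.exp (-(5 / 8 * m * t ^ 2)) := by
        rw [← Real.exp_nat_mul, ← Real.exp_add]
        congr 1
        push_cast
        ring

theorem measureReal_le_one_sub (hΦ : IsQuaternionGaussianMatrix Φ P)
    (hm : m ≠ 0) {x : Fin n → ℍ} (hx : quaternionL2Norm x = 1) {t : ℝ} (ht : 0 ≤ t)
    (ht' : t < 1) :
    P.real {ω | quaternionL2Norm ((Φ ω).mulVec x) ^ 2 ≤ 1 - t} ≤
      Real.exp (-(5 / 8 * m * t ^ 2)) := by
  have hm' : (0 : ℝ) < m := by positivity
  have ht1 : 0 < 1 - t := by linarith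
  have hneg : -(2 * m * t / (1 - t)) ≤ 0 := by
    rw [neg_nonpos]
    positivity
  have hθ : -(2 * m * t / (1 - t)) < 2 * m := by linarith
  refine (measure_le_le_exp_mul_mgf (1 - t) hneg
    (hΦ.integrable_exp_mul_norm_mulVec_sq hm hx hθ)).trans ?_
  rw [hΦ.mgf_norm_mulVec_sq hm hx hθ]
  have h1 : 1 - -(2 * m * t / (1 - t)) / (2 * m) = (1 - t)⁻¹ := by
    field_simp
    ring
  have h2 : - -(2 * m * t / (1 - t)) * (1 - t) = 2 * m * t := by field_simp
  rw [h1, h2, inv_pow, inv_inv]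
  calc Real.exp (2 * m * t) * (1 - t) ^ (2 * m)
      ≤ Real.exp (2 * m * t) * Real.exp (-t - 5 / 16 * t ^ 2) ^ (2 * m) := by
        gcongr
        exact one_sub_le_exp_neg_sub_sq ht ht'
    _ = Real.exp (-(5 / 8 * m * t ^ 2)) := by
        rw [← Real.exp_nat_mul, ← Real.exp_add]
        congr 1
        push_cast
        ring

/-- Concentration of `‖Φ x‖₂²` around `1` for a unit vector `x`. -/
theorem measureReal_lt_abs_sub_one_le (hΦ : IsQuaternionGaussianMatrix Φ P)
    (hm : m ≠ 0) {x : Fin n → ℍ} (hx : quaternionL2Norm x = 1) {t : ℝ} (ht : 0 ≤ t)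
    (ht' : t ≤ 1 / 2) :
    P.real {ω | t < |quaternionL2Norm ((Φ ω).mulVec x) ^ 2 - 1|} ≤
      2 * Real.exp (-(5 / 8 * m * t ^ 2)) := by
  have hsub : {ω | t < |quaternionL2Norm ((Φ ω).mulVec x) ^ 2 - 1|} ⊆
      {ω | 1 + t ≤ quaternionL2Norm ((Φ ω).mulVec x) ^ 2} ∪
        {ω | quaternionL2Norm ((Φ ω).mulVec x) ^ 2 ≤ 1 - t} := fun ω hω => by
    rcases lt_abs.1 (show t < |_| from hω) with h | h
    · left
      simp only [Set.mem_ofPred_eq]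
      linarith
    · right
      simp only [Set.mem_ofPred_eq]
      linarith
  refine (measureReal_mono hsub).trans ((measureReal_union_le _ _).trans ?_)
  linarith [hΦ.measureReal_one_add_le hm hx ht ht',
    hΦ.measureReal_le_one_sub hm hx ht (by linarith)]

end IsQuaternionGaussianMatrix

/-! ### From nets on supports to the restricted isometry property -/

theorem quaternionL2Norm_nonneg {n : ℕ} (x : Fin n → ℍ) : 0 ≤ quaternionL2Norm x :=
  Real.sqrt_nonneg _

/-- Extension by zero of a vector of quaternions supported on `S`. -/
noncomputable def quaternionExtend {n : ℕ} (S : Finset (Fin n)) (y : PiLp 2 fun _ : S => ℍ) :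
    Fin n → ℍ :=
  fun i => if h : i ∈ S then y ⟨i, h⟩ else 0

theorem quaternionL2Norm_extend {n : ℕ} (S : Finset (Fin n)) (y : PiLp 2 fun _ : S => ℍ) :
    quaternionL2Norm (quaternionExtend S y) = ‖y‖ := by
  rw [← sq_eq_sq₀ (quaternionL2Norm_nonneg _) (norm_nonneg _), quaternionL2Norm_sq,
    PiLp.norm_sq_eq_of_L2, ← Finset.sum_subset (Finset.subset_univ S), ← Finset.sum_coe_sort]
  · simp [quaternionExtend]
  · intro i _ hi
    simp [quaternionExtend, hi]

/-- The action of a quaternion matrix on the vectors supported on `S`, as a real linear map. -/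
noncomputable def mulVecExtend {m n : ℕ} (Φ : Matrix (Fin m) (Fin n) ℍ) (S : Finset (Fin n)) :
    (PiLp 2 fun _ : S => ℍ) →ₗ[ℝ] PiLp 2 fun _ : Fin m => ℍ where
  toFun y := WithLp.toLp 2 (Φ.mulVec (quaternionExtend S y))
  map_add' y z := by
    refine (congrArg (WithLp.toLp 2) ?_).trans (WithLp.toLp_add 2 _ _)
    rw [← Matrix.mulVec_add]
    congr 1
    ext1 i
    by_cases h : i ∈ S <;> simp [quaternionExtend, h]
  map_smul' r y := by
    refine (congrArg (WithLp.toLp 2) ?_).trans (WithLp.toLp_smul 2 _ _)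
    rw [RingHom.id_apply, ← Matrix.mulVec_smul]
    congr 1
    ext1 i
    by_cases h : i ∈ S <;> simp [quaternionExtend, h]

theorem norm_mulVecExtend {m n : ℕ} (Φ : Matrix (Fin m) (Fin n) ℍ) (S : Finset (Fin n))
    (y : PiLp 2 fun _ : S => ℍ) :
    ‖mulVecExtend Φ S y‖ = quaternionL2Norm (Φ.mulVec (quaternionExtend S y)) := by
  rw [← sq_eq_sq₀ (norm_nonneg _) (quaternionL2Norm_nonneg _), quaternionL2Norm_sq,
    PiLp.norm_sq_eq_of_L2]
  rfl

/-- A finite set of unit vectors which is fine enough to test the restricted isometry property. -/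
theorem exists_finset_hasRIP {n s : ℕ} (hsn : s ≤ n) {ρ : ℝ} (hρ : 0 < ρ) (hρ' : 2 * ρ < 1) :
    ∃ N : Finset (Fin n → ℍ), (∀ c ∈ N, quaternionL2Norm c = 1) ∧
      (N.card : ℝ) ≤ n.choose s * (1 + 2 / ρ) ^ (4 * s) ∧
      ∀ {m : ℕ} (Φ : Matrix (Fin m) (Fin n) ℍ) (t : ℝ),
        (∀ c ∈ N, |quaternionL2Norm (Φ.mulVec c) ^ 2 - 1| ≤ t) →
          HasRIP Φ s (t / (1 - 2 * ρ)) := by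
  classical
  have hfin : ∀ S : Finset (Fin n), Module.finrank ℝ (PiLp 2 fun _ : S => ℍ) = 4 * S.card :=
    fun S => by
      rw [(WithLp.linearEquiv 2 ℝ (S → ℍ)).finrank_eq, Module.finrank_pi_fintype]
      simp [Quaternion.finrank_eq_four, mul_comm]
  choose N hN1 hNcard hNnet using fun S : Finset (Fin n) =>
    exists_finset_net_unit_sphere (E := PiLp 2 fun _ : S => ℍ) hρ
  refine ⟨(Finset.powersetCard s Finset.univ).biUnion fun S => (N S).image (quaternionExtend S),
    ?_, ?_, ?_⟩
  · intro c hc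
    obtain ⟨S, -, hc⟩ := Finset.mem_biUnion.1 hc
    obtain ⟨y, hy, rfl⟩ := Finset.mem_image.1 hc
    rw [quaternionL2Norm_extend, hN1 S y hy]
  · refine (Nat.cast_le.2 Finset.card_biUnion_le).trans ?_
    push_cast
    have hle : ∀ S ∈ Finset.powersetCard s (Finset.univ : Finset (Fin n)),
        (((N S).image (quaternionExtend S)).card : ℝ) ≤ (1 + 2 / ρ) ^ (4 * s) := fun S hS => by
      refine (Nat.cast_le.2 Finset.card_image_le).trans ((hNcard S).trans_eq ?_)
      rw [hfin, (Finset.mem_powersetCard.1 hS).2]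
    refine (Finset.sum_le_sum hle).trans_eq ?_
    simp
  · intro m Φ t hΦ x hx
    have hsupp : (Finset.univ.filter fun i => x i ≠ 0).card ≤ s := by
      rw [← Set.ncard_coe_finset]
      simpa [IsSparse] using hx
    -- Enlarging the support to exactly `s` indices, possible as `s ≤ n`, leaves only `n.choose s`
    -- sets to count.
    obtain ⟨S, hxS, hS⟩ := Finset.exists_superset_card_eq hsupp (by simpa using hsn)
    have hxe : quaternionExtend S (WithLp.toLp 2 fun i : S => x i) = x := by
      ext1 i
      by_cases hi : i ∈ S
      · simp [quaternionExtend, hi]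
      · have : x i = 0 := by
          by_contra h
          exact hi (hxS (by simpa using h))
        simp [quaternionExtend, hi, this]
    have h := abs_norm_sq_sub_le_of_net (mulVecExtend Φ S) hρ hρ' (N S) (hN1 S) (hNnet S)
      (t := t) (fun c hc => by
        rw [norm_mulVecExtend]
        exact hΦ _ (Finset.mem_biUnion.2 ⟨S, by simp [hS], Finset.mem_image_of_mem _ hc⟩))
      (WithLp.toLp 2 fun i : S => x i)
    rw [norm_mulVecExtend, ← quaternionL2Norm_extend, hxe, abs_le] at h
    constructor
    · linarith [h.1]
    · linarith [h.2]

/-! ### Counting estimates and the union bound -/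

theorem choose_le_exp_mul {n s : ℕ} (hs : 1 ≤ s) (hsn : s ≤ n) :
    (n.choose s : ℝ) ≤ Real.exp (s + s * Real.log (n / s)) := by
  have hs' : (0 : ℝ) < s := by exact_mod_cast hs
  have hn' : (0 : ℝ) < n := by exact_mod_cast hs.trans hsn
  -- `s^s / s!` is one term of the series for `exp s`.
  have h := Real.pow_div_factorial_le_exp s hs'.le s
  rw [Real.exp_add, mul_comm (s : ℝ) (Real.log _), Real.exp_mul, Real.exp_log (by positivity),
    Real.rpow_natCast]
  calc (n.choose s : ℝ) ≤ (n : ℝ) ^ s / s.factorial := Nat.choose_le_pow_div s n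
    _ = (s : ℝ) ^ s / s.factorial * (n / s) ^ s := by
      rw [div_pow]
      field_simp
    _ ≤ Real.exp s * (n / s) ^ s := by gcongr

/-- Here `17 = 1 + 2/ρ` at `ρ = 1/8`; the exponent `14s` and the `s` from the binomial coefficient
make up `15s`. -/
theorem seventeen_pow_le_exp (s : ℕ) : (17 : ℝ) ^ (4 * s) ≤ Real.exp (14 * s) := by
  have h : (17 : ℝ) ^ 4 ≤ Real.exp 14 := by
    have h1 : (2.7 : ℝ) ≤ Real.exp 1 := by linarith [Real.exp_one_gt_d9]
    calc (17 : ℝ) ^ 4 ≤ 2.7 ^ 14 := by norm_num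
      _ ≤ Real.exp 1 ^ 14 := by gcongr
      _ = Real.exp 14 := by
        rw [← Real.exp_nat_mul]
        norm_num
  rw [pow_mul, mul_comm, Real.exp_nat_mul]
  gcongr

theorem theorem4p2 {Ω : Type*} [MeasurableSpace Ω] (P : Measure Ω) [IsProbabilityMeasure P]
    (m n s : ℕ) (hs : 1 ≤ s) (hsn : s ≤ n)
    (Φ : Ω → Matrix (Fin m) (Fin n) ℍ) (hΦ : IsQuaternionGaussianMatrix Φ P)
    (δ ε : ℝ) (hδ : δ ∈ Set.Ioo 0 (1 / Real.sqrt 3)) (hε : ε ∈ Set.Ioo 0 1)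
    (hm : 10 / 3 * (δ ^ 2)⁻¹ *
      (15 * (s : ℝ) + Real.log (2 / ε) + s * Real.log ((n : ℝ) / s)) ≤ (m : ℝ)) :
    1 - ε ≤ P.real {ω | ric (Φ ω) s < δ} := by
  obtain ⟨hδ0, hδ3⟩ := hδ
  obtain ⟨hε0, hε1⟩ := hε
  have hs' : (1 : ℝ) ≤ s := by exact_mod_cast hs
  have hlog1 : 0 < Real.log (2 / ε) := Real.log_pos (by rw [lt_div_iff₀ hε0]; linarith)
  have hlog2 : 0 ≤ Real.log ((n : ℝ) / s) :=
    Real.log_nonneg (by rw [le_div_iff₀ (by linarith), one_mul]; exact_mod_cast hsn)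
  have hm0 : m ≠ 0 := by
    rintro rfl
    have : 0 < 10 / 3 * (δ ^ 2)⁻¹ *
      (15 * (s : ℝ) + Real.log (2 / ε) + s * Real.log ((n : ℝ) / s)) := by positivity
    rw [Nat.cast_zero] at hm
    linarith
  have hδsq : δ ^ 2 < 1 / 3 := by
    calc δ ^ 2 < (1 / Real.sqrt 3) ^ 2 := by gcongr
      _ = 1 / 3 := by rw [div_pow, one_pow, Real.sq_sqrt (by norm_num)]
  have ht2 : 7 / 10 * δ ≤ 1 / 2 := by nlinarith
  have hexp : 15 * (s : ℝ) + Real.log (2 / ε) + s * Real.log ((n : ℝ) / s) ≤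
      5 / 8 * m * (7 / 10 * δ) ^ 2 := by
    have h1 : 10 * (15 * (s : ℝ) + Real.log (2 / ε) + s * Real.log ((n : ℝ) / s)) ≤
        m * (3 * δ ^ 2) := by
      rw [← div_le_iff₀ (by positivity)]
      refine le_of_eq_of_le ?_ hm
      field_simp
    have h2 : 0 ≤ m * δ ^ 2 := by positivity
    nlinarith
  obtain ⟨N, hN1, hNcard, hNrip⟩ :=
    exists_finset_hasRIP (ρ := 1 / 8) hsn (by norm_num) (by norm_num)
  have hbad : P.real (⋃ c ∈ N, {ω | 7 / 10 * δ < |quaternionL2Norm ((Φ ω).mulVec c) ^ 2 - 1|})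
      ≤ ε := by
    calc _ ≤ ∑ c ∈ N, P.real {ω | 7 / 10 * δ < |quaternionL2Norm ((Φ ω).mulVec c) ^ 2 - 1|} :=
          measureReal_biUnion_finset_le _ _
      _ ≤ ∑ c ∈ N, 2 * Real.exp (-(5 / 8 * m * (7 / 10 * δ) ^ 2)) :=
          Finset.sum_le_sum fun c hc =>
            hΦ.measureReal_lt_abs_sub_one_le hm0 (hN1 c hc) (by positivity) ht2
      _ = N.card * (2 * Real.exp (-(5 / 8 * m * (7 / 10 * δ) ^ 2))) := by simp
      _ ≤ (Real.exp (s + s * Real.log (n / s)) * Real.exp (14 * s)) *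
          (2 * Real.exp (-(15 * (s : ℝ) + Real.log (2 / ε) + s * Real.log ((n : ℝ) / s)))) := by
        gcongr
        refine hNcard.trans ?_
        norm_num only
        gcongr
        · exact choose_le_exp_mul hs hsn
        · exact seventeen_pow_le_exp s
      _ = 2 * Real.exp (-Real.log (2 / ε)) := by
        rw [mul_left_comm, ← Real.exp_add, ← Real.exp_add]
        congr 2
        ring
      _ = ε := by
        rw [Real.exp_neg, Real.exp_log (by positivity)]
        field_simp
  -- Covering the whole space and using subadditivity avoids proving `{ric < δ}` measurable.
  have hcover : (Set.univ : Set Ω) ⊆ {ω | ric (Φ ω) s < δ} ∪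
      ⋃ c ∈ N, {ω | 7 / 10 * δ < |quaternionL2Norm ((Φ ω).mulVec c) ^ 2 - 1|} := by
    intro ω _
    by_cases hω : ∀ c ∈ N, |quaternionL2Norm ((Φ ω).mulVec c) ^ 2 - 1| ≤ 7 / 10 * δ
    · left
      have hric := (isLeast_ric (Φ ω) s).2 ⟨by norm_num; linarith, hNrip (Φ ω) _ hω⟩
      refine lt_of_le_of_lt hric ?_
      norm_num
      linarith
    · right
      push Not at hω
      obtain ⟨c, hc, hlt⟩ := hω
      exact Set.mem_biUnion hc hlt
  have htotal := (measureReal_mono (μ := P) hcover).trans (measureReal_union_le _ _)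
  rw [probReal_univ] at htotal
  linarith
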